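/- For a positive integer $n$ let $\mathrm{MAJ}_n\colon\{0,1\}^n\to\{0,1\}$ be the majority function, $\mathrm{MAJ}_n(x_1,\dots,x_n)=1$ if and only if $\sum_{i=1}^n x_i\ge n/2$. A monotone threshold gate with inputs $y_1,\dots,y_m\in\{0,1\}$ outputs $1$ if and only if $\sum_{i=1}^m c_i y_i\ge t$, where the coefficients $c_i$ are positive integers and the threshold $t$ is an arbitrary integer; its total weight is $\sum_{i=1}^m c_i$. A depth-2 monotone threshold circuit on $n$ bits consists of finitely many such gates whose inputs are among the $n$ input bits, together with one such top gate whose inputs are the outputs of these bottom gates. Theorem. There is an absolute constant $c>0$ such that for every integer $n\ge 2$ and every integer $k\ge 0$: if there is a depth-2 monotone threshold circuit on $n$ bits in which every gate (the top gate included) has total weight at most $k$ and which computes $\mathrm{MAJ}_n$ correctly on every input in $\{0,1\}^n$, then $$k\ \ge\ c\, n^{13/19}(\log n)^{-2/19}.$$ In other words, $k=\Omega\left(n^{13/19}(\log n)^{-2/19}\right)$. -/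

import Mathlib

/-- The majority function `MAJ_n(x₁, …, x_n) = [∑ xᵢ ≥ n / 2]` (rational division). -/
def majority (n : ℕ) (x : Fin n → Bool) : Bool :=
  decide ((n : ℚ) / 2 ≤ ∑ i, ((x i).toNat : ℚ))

/-- A monotone threshold gate `[∑ cᵢ xᵢ ≥ t]` on inputs indexed by `ι`.
Coefficients are natural numbers, and `weight i = 0` means that the gate does not read input `i`,
so the inputs that the gate reads have positive integer coefficients. The threshold is an arbitrary
integer (as the weighted sum is an integer, a real threshold could be replaced by its ceiling). -/
structure ThresholdGate (ι : Type*) where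
  weight : ι → ℕ
  threshold : ℤ

namespace ThresholdGate

/-- The sum of the coefficients of a gate. -/
def totalWeight {ι : Type*} [Fintype ι] (G : ThresholdGate ι) : ℕ := ∑ i, G.weight i

/-- The Boolean value `[∑ cᵢ xᵢ ≥ t]` of a gate. -/
def eval {ι : Type*} [Fintype ι] (G : ThresholdGate ι) (x : ι → Bool) : Bool :=
  decide (G.threshold ≤ ∑ i, (G.weight i : ℤ) * ((x i).toNat : ℤ))

end ThresholdGate

/-- A depth-two monotone threshold circuit on `n` input bits: finitely many bottom gates reading the
input bits, and a top gate reading the bottom gates. Different bottom gates may coincide. An input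
bit or a constant fed to the top gate is itself the value of a bottom gate, of total weight `1`
or `0`. -/
structure DepthTwoCircuit (n : ℕ) where
  numBottom : ℕ
  bottom : Fin numBottom → ThresholdGate (Fin n)
  top : ThresholdGate (Fin numBottom)

namespace DepthTwoCircuit

/-- The Boolean function that the circuit computes. -/
def eval {n : ℕ} (F : DepthTwoCircuit n) (x : Fin n → Bool) : Bool :=
  F.top.eval fun j => (F.bottom j).eval x

/-- Every gate of the circuit, the top gate included, has total weight at most `k`. -/
def WeightAtMost {n : ℕ} (F : DepthTwoCircuit n) (k : ℕ) : Prop :=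
  F.top.totalWeight ≤ k ∧ ∀ j, (F.bottom j).totalWeight ≤ k

/-- The circuit computes `MAJ_n` correctly on every input. -/
def ComputesMajority {n : ℕ} (F : DepthTwoCircuit n) : Prop :=
  ∀ x : Fin n → Bool, F.eval x = majority n x

end DepthTwoCircuit

/-!
The bound holds in the stronger form `n / 32 ≤ k * log n`. The proof combines the polynomial method
modulo primes with a count of the flips of gates along one chain of inputs.

Let `m = ⌈n / 2⌉`. If `S` is an input with `m - 1` ones and `i ∉ S`, then adding `i` to `S` changes
the value of the circuit, so some bottom gate with positive coefficient in the top gate flips when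
`i` is added, that is, its weighted sum on `S` is one of the `w` integers just below its threshold,
where `w` is the weight it gives to `i`. Hence for fixed `i` a family of `∑ w` integer affine forms
has the property that each such `S` is a zero of one of them.

Let `p > k` be a prime, let `A` have `m - 1 - p` elements, and suppose that `i ∉ A` has total weight
at most `k < p` in the bottom gates. On a set `U` of `2 * p - 1` further variables, the product of
the forms modulo `p` is a polynomial of degree less than `p` vanishing on the `p`-subsets of `U`.
For such a polynomial the sum over the `p`-subsets equals the value at `∅` modulo `p`
(`sum_powersetCard_eq_apply_empty`): a set of `t` variables lies in `choose (2 * p - 1 - t) (p - t)`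
of the `p`-subsets, a number divisible by `p` when `0 < t < p` and congruent to `1` when `t = 0`.
So one of the forms is divisible by `p` at `A`, and as its value is less than `p` in absolute value,
it is zero: a gate already flips when `i` is added to `A` (`exists_flips_of_prime`).

At most `k` variables have total weight above `k`. Add the other ones to the empty input one at a
time. For every prime `p` in `(k, m - 1]`, some gate flips at the step that starts from `m - 1 - p`
ones. A monotone gate flips at most once, and at most `k` gates count, so there are at most `k` such
primes, and `π (m - 1) ≤ 2 * k` (`primeCounting_le_two_mul`). Chebyshev's lower bound for `π`
finishes the proof.
-/

open Finset

/-! ### Functions of bounded degree on the cube -/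

section Degree

variable {α : Type*} [DecidableEq α] {R : Type*} [CommRing R]

/-- The monomial `∏ i ∈ T, x i` as a function on the cube, whose points are given by the finite sets
of coordinates equal to one. -/
def cubeMonomial (R : Type*) [CommRing R] (T S : Finset α) : R := if T ⊆ S then 1 else 0

/-- The functions on the cube that are combinations of monomials of degree at most `d`. -/
def cubeDegreeLE (α R : Type*) [DecidableEq α] [CommRing R] (d : ℕ) :
    Submodule R (Finset α → R) :=
  Submodule.span R {f | ∃ T : Finset α, #T ≤ d ∧ f = cubeMonomial R T}

theorem mul_affine_mem_cubeDegreeLE [Fintype α] {d : ℕ} {f : Finset α → R}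
    (hf : f ∈ cubeDegreeLE α R d) (a : R) (c : α → R) :
    (fun S => f S * (a + ∑ v ∈ S, c v)) ∈ cubeDegreeLE α R (d + 1) := by
  induction hf using Submodule.span_induction with
  | mem f hf =>
    obtain ⟨T, hT, rfl⟩ := hf
    have h : (fun S => cubeMonomial R T S * (a + ∑ v ∈ S, c v)) =
        a • cubeMonomial R T + ∑ v, c v • cubeMonomial R (insert v T) := by
      ext S
      have hS : ∑ v ∈ S, c v = ∑ v, if v ∈ S then c v else 0 := by simp
      simp only [hS, Pi.add_apply, Pi.smul_apply, Finset.sum_apply, smul_eq_mul, cubeMonomial,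
        insert_subset_iff]
      by_cases h : T ⊆ S <;> simp [h]
    rw [h]
    refine add_mem (Submodule.smul_mem _ _ (Submodule.subset_span ⟨T, by lia, rfl⟩))
      (sum_mem fun v _ => Submodule.smul_mem _ _ (Submodule.subset_span ⟨insert v T, ?_, rfl⟩))
    exact (card_insert_le v T).trans (by lia)
  | zero =>
    convert zero_mem (cubeDegreeLE α R (d + 1)) using 1
    ext S
    simp
  | add f g _ _ hf hg =>
    convert add_mem hf hg using 1
    ext S
    simp [add_mul]
  | smul r f _ hf =>
    convert Submodule.smul_mem _ r hf using 1
    ext S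
    simp [mul_assoc]

theorem prod_affine_mem_cubeDegreeLE [Fintype α] {ι : Type*} (I : Finset ι) (a : ι → R)
    (c : ι → α → R) :
    (fun S => ∏ j ∈ I, (a j + ∑ v ∈ S, c j v)) ∈ cubeDegreeLE α R #I := by
  classical
  induction I using Finset.induction_on with
  | empty => exact Submodule.subset_span ⟨∅, by simp, by ext S; simp [cubeMonomial]⟩
  | insert j I hj ih =>
    rw [card_insert_of_notMem hj]
    convert mul_affine_mem_cubeDegreeLE ih (a j) (c j) using 2 with S
    rw [prod_insert hj, mul_comm]

end Degree

/-! ### The covering lemma modulo a prime -/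

section Covering

variable {α : Type*} [DecidableEq α]

/-- Modulo `p`, summing over the `p`-subsets of a `(2 * p - 1)`-element set evaluates a function of
degree less than `p` at the origin. -/
theorem sum_powersetCard_eq_apply_empty {p : ℕ} (hp : p.Prime) {U : Finset α}
    (hU : #U = 2 * p - 1) {d : ℕ} (hd : d < p) {f : Finset α → ZMod p}
    (hf : f ∈ cubeDegreeLE α (ZMod p) d) :
    ∑ S ∈ U.powersetCard p, f S = f ∅ := by
  have := hp.two_le
  induction hf using Submodule.span_induction with
  | mem f hf =>
    obtain ⟨T, hT, rfl⟩ := hf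
    simp only [cubeMonomial, sum_boole, subset_empty]
    by_cases hTU : T ⊆ U
    · rw [card_filter_powersetCard_subset _ _ _ hTU (by lia), hU]
      rcases T.eq_empty_or_nonempty with rfl | hne
      · have : Fact p.Prime := ⟨hp⟩
        have h := Choose.choose_modEq_choose_mod_mul_choose_div_nat
          (n := 2 * p - 1) (k := p) (p := p)
        rw [show 2 * p - 1 = p - 1 + p by lia, Nat.add_mod_right, Nat.mod_self,
          Nat.choose_zero_right, Nat.add_div_right _ hp.pos, Nat.div_eq_of_lt (by lia), Nat.div_self hp.pos] at h
        rw [card_empty, show 2 * p - 1 - 0 = p - 1 + p by lia]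
        simpa using (ZMod.natCast_eq_natCast_iff _ _ _).2 h
      · have hpos := hne.card_pos
        have h : p ∣ (2 * p - 1 - #T).choose (p - #T) := by
          have := hp.dvd_choose_add (a := p - #T) (b := p - 1) (by lia) (by lia) (by lia)
          rwa [show p - #T + (p - 1) = 2 * p - 1 - #T by lia] at this
        rw [(ZMod.natCast_eq_zero_iff _ _).2 h, if_neg hne.ne_empty]
    · have hne : T ≠ ∅ := by rintro rfl; simp at hTU
      rw [if_neg hne, filter_false_of_mem, card_empty, Nat.cast_zero]
      exact fun S hS h => hTU (h.trans (mem_powersetCard.1 hS).1)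
  | zero => simp
  | add f g _ _ hf hg => simp [sum_add_distrib, hf, hg]
  | smul r f _ hf => simp [← mul_sum, hf]

/-- If every `p`-subset of `U`, where `#U = 2 * p - 1`, is a zero of one of fewer than `p` integer
affine forms, then `p` divides the constant term of one of them. -/
theorem exists_dvd_of_forall_exists_eq_zero [Fintype α] {p : ℕ} (hp : p.Prime) {U : Finset α}
    (hU : #U = 2 * p - 1) {ι : Type*} {I : Finset ι} (hI : #I < p) (a : ι → ℤ) (c : ι → α → ℤ)
    (h : ∀ S ⊆ U, #S = p → ∃ j ∈ I, a j + ∑ v ∈ S, c j v = 0) :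
    ∃ j ∈ I, (p : ℤ) ∣ a j := by
  have : Fact p.Prime := ⟨hp⟩
  have key := sum_powersetCard_eq_apply_empty hp hU hI
    (prod_affine_mem_cubeDegreeLE I (fun j => (a j : ZMod p)) (fun j v => (c j v : ZMod p)))
  rw [sum_eq_zero] at key
  · obtain ⟨j, hj, h0⟩ := prod_eq_zero_iff.1 key.symm
    exact ⟨j, hj, (ZMod.intCast_zmod_eq_zero_iff_dvd _ _).1 (by simpa using h0)⟩
  · intro S hS
    obtain ⟨hSU, hSp⟩ := mem_powersetCard.1 hS
    obtain ⟨j, hj, h0⟩ := h S hSU hSp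
    exact prod_eq_zero hj (by exact_mod_cast congrArg (Int.cast : ℤ → ZMod p) h0)

end Covering

/-! ### Flipping gates -/

namespace ThresholdGate

variable {ι : Type*}

/-- The weighted sum that the gate computes on the input whose ones are the elements of `S`. -/
def value (G : ThresholdGate ι) (S : Finset ι) : ℕ := ∑ v ∈ S, G.weight v

theorem value_mono (G : ThresholdGate ι) {S T : Finset ι} (h : S ⊆ T) : G.value S ≤ G.value T :=
  sum_le_sum_of_subset h

/-- Adding `i` to the input `S` makes the weighted sum pass the threshold. -/
def Flips [DecidableEq ι] (G : ThresholdGate ι) (S : Finset ι) (i : ι) : Prop :=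
  (G.value S : ℤ) < G.threshold ∧ G.threshold ≤ G.value (insert i S)

variable [Fintype ι]

theorem value_le_totalWeight (G : ThresholdGate ι) (S : Finset ι) : G.value S ≤ G.totalWeight :=
  G.value_mono (subset_univ S)

variable [DecidableEq ι]

theorem eval_mem (G : ThresholdGate ι) (S : Finset ι) :
    G.eval (fun i => decide (i ∈ S)) = decide (G.threshold ≤ G.value S) := by
  simp [eval, value, Bool.toNat, Bool.cond_decide]

end ThresholdGate

theorem majority_mem {n : ℕ} (S : Finset (Fin n)) :
    majority n (fun i => decide (i ∈ S)) = decide (n ≤ 2 * #S) := by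
  have h : ∑ i, ((decide (i ∈ S)).toNat : ℚ) = #S := by
    simp [Bool.toNat, Bool.cond_decide]
  rw [majority, h, decide_eq_decide, div_le_iff₀ two_pos, mul_comm]
  exact_mod_cast Iff.rfl

namespace DepthTwoCircuit

variable {n k : ℕ} {F : DepthTwoCircuit n}

/-- The bottom gates that the top gate reads. -/
def support (F : DepthTwoCircuit n) : Finset (Fin F.numBottom) := {j | F.top.weight j ≠ 0}

theorem card_support_le (hk : F.WeightAtMost k) : #F.support ≤ k := by
  refine le_trans ?_ hk.1
  rw [card_eq_sum_ones]
  refine (sum_le_sum fun j hj => ?_).trans (F.top.value_le_totalWeight F.support)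
  exact Nat.one_le_iff_ne_zero.2 (mem_filter.1 hj).2

/-- An input just below the threshold of majority is critical, whence some gate flips. -/
theorem exists_flips (hF : F.ComputesMajority) {S : Finset (Fin n)} {i : Fin n} (hi : i ∉ S)
    (hS : #S + 1 = (n + 1) / 2) : ∃ j ∈ F.support, (F.bottom j).Flips S i := by
  by_contra! hno
  have h0 := hF (fun v => decide (v ∈ S))
  have h1 := hF (fun v => decide (v ∈ insert i S))
  rw [majority_mem, decide_eq_false (by lia)] at h0
  rw [majority_mem, card_insert_of_notMem hi, decide_eq_true (by lia)] at h1
  simp only [DepthTwoCircuit.eval, ThresholdGate.eval_mem] at h0 h1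
  simp only [ThresholdGate.eval, decide_eq_true_eq, decide_eq_false_iff_not, not_le] at h0 h1
  refine absurd (h1.trans (sum_le_sum fun j _ => ?_)) (not_le.2 h0)
  by_cases hj : F.top.weight j = 0
  · simp [hj]
  · have hfl := hno j (by simp [support, hj])
    rw [ThresholdGate.Flips, not_and, not_le] at hfl
    refine mul_le_mul_of_nonneg_left ?_ (by positivity)
    by_cases h : (F.bottom j).threshold ≤ ((F.bottom j).value S : ℤ)
    · simpa [h] using Bool.toNat_le _
    · simp [h, hfl (not_le.1 h)]

/-- For a prime `p > k`, a gate still flips when a variable of small total weight is added to an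
input with `p` ones fewer than a critical one. -/
theorem exists_flips_of_prime (hk : F.WeightAtMost k) (hF : F.ComputesMajority) {p : ℕ}
    (hp : p.Prime) (hkp : k < p) {A : Finset (Fin n)} {i : Fin n} (hi : i ∉ A)
    (hA : #A + p + 1 = (n + 1) / 2) (hw : ∑ j ∈ F.support, (F.bottom j).weight i ≤ k) :
    ∃ j ∈ F.support, (F.bottom j).Flips A i := by
  obtain ⟨U, hUA, hU⟩ := exists_subset_card_eq (s := (insert i A)ᶜ) (n := 2 * p - 1)
    (by rw [card_compl, card_insert_of_notMem hi, Fintype.card_fin]; lia)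
  have hval (j : Fin F.numBottom) (S : Finset (Fin n)) : (F.bottom j).value S ≤ k :=
    ((F.bottom j).value_le_totalWeight S).trans (hk.2 j)
  -- The index `(j, u)` stands for the condition that the sum of gate `j` is `u + 1` below its
  -- threshold. Values outside `[0, k]` are not attained, and are left out because `p` may divide
  -- the corresponding form at `A`.
  let I : Finset (Σ _ : Fin F.numBottom, ℕ) :=
    {q ∈ F.support.sigma fun j => range ((F.bottom j).weight i) |
      0 ≤ (F.bottom q.1).threshold - 1 - q.2 ∧ (F.bottom q.1).threshold - 1 - q.2 ≤ k}
  have hI : #I < p := by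
    refine ((card_filter_le _ _).trans ?_).trans_lt hkp
    simpa [card_sigma] using hw
  obtain ⟨⟨j, u⟩, hq, hdvd⟩ := exists_dvd_of_forall_exists_eq_zero hp hU hI
    (fun q => (F.bottom q.1).value A - ((F.bottom q.1).threshold - 1 - q.2))
    (fun q v => (F.bottom q.1).weight v) fun S hSU hSp => by
      have hd : Disjoint A S := by
        refine disjoint_left.2 fun v hv hvS => ?_
        simpa [hv] using hUA (hSU hvS)
      have hiS : i ∉ A ∪ S := by
        refine fun h => (mem_union.1 h).elim hi fun h => ?_
        simpa using hUA (hSU h)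
      obtain ⟨j, hj, hlt, hle⟩ := exists_flips hF hiS (by rw [card_union_of_disjoint hd]; lia)
      have hv : (F.bottom j).value (insert i (A ∪ S)) =
          (F.bottom j).weight i + (F.bottom j).value (A ∪ S) := sum_insert hiS
      have hAS : (F.bottom j).value (A ∪ S) =
          (F.bottom j).value A + ∑ v ∈ S, (F.bottom j).weight v := sum_union hd
      have hvk := hval j (A ∪ S)
      refine ⟨⟨j, ((F.bottom j).threshold - 1 - (F.bottom j).value (A ∪ S)).toNat⟩, ?_, ?_⟩
      · simp only [I, mem_filter, mem_sigma, mem_range, hj, true_and]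
        lia
      · dsimp only
        rw [← Nat.cast_sum]
        lia
  simp only [I, mem_filter, mem_sigma, mem_range] at hq
  dsimp only at hdvd
  have hAk := hval j A
  have h0 := Int.eq_zero_of_abs_lt_dvd hdvd (by rw [abs_lt]; lia)
  have hv : (F.bottom j).value (insert i A) = (F.bottom j).weight i + (F.bottom j).value A :=
    sum_insert hi
  exact ⟨j, hq.1.1, by lia, by lia⟩

/-! ### Counting flips along a chain -/

/-- All but `k` variables have total weight at most `k` in the bottom gates that matter. -/
theorem le_card_light_add (hk : F.WeightAtMost k) :
    n ≤ #{i : Fin n | ∑ j ∈ F.support, (F.bottom j).weight i ≤ k} + k := by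
  have hsum : ∑ i, ∑ j ∈ F.support, (F.bottom j).weight i ≤ k * k := by
    rw [sum_comm]
    calc ∑ j ∈ F.support, ∑ i, (F.bottom j).weight i ≤ #F.support * k := by
          rw [← smul_eq_mul]
          exact sum_le_card_nsmul _ _ k fun j _ => hk.2 j
      _ ≤ k * k := Nat.mul_le_mul_right k (card_support_le hk)
  have hheavy : #{i : Fin n | k < ∑ j ∈ F.support, (F.bottom j).weight i} ≤ k := by
    by_contra! hlt
    have h1 := card_nsmul_le_sum {i : Fin n | k < ∑ j ∈ F.support, (F.bottom j).weight i}
      (fun i => ∑ j ∈ F.support, (F.bottom j).weight i) (k + 1)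
      fun i hi => (mem_filter.1 hi).2
    have h2 := sum_le_sum_of_subset (f := fun i => ∑ j ∈ F.support, (F.bottom j).weight i)
      (subset_univ {i : Fin n | k < ∑ j ∈ F.support, (F.bottom j).weight i})
    rw [smul_eq_mul] at h1
    have h3 := (Nat.mul_le_mul_right (k + 1) hlt).trans (h1.trans (h2.trans hsum))
    lia
  have := card_filter_add_card_filter_not (s := (univ : Finset (Fin n)))
    (fun i => ∑ j ∈ F.support, (F.bottom j).weight i ≤ k)
  simp only [not_le, card_univ, Fintype.card_fin] at this
  lia

/-- Along a chain through the light variables each gate flips at most once, while each prime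
accounts for a flip at a step of its own. -/
theorem card_primes_le (hk : F.WeightAtMost k) (hF : F.ComputesMajority) :
    #{p ∈ Ioc k ((n - 1) / 2) | p.Prime} ≤ k := by
  set L : Finset (Fin n) := {i | ∑ j ∈ F.support, (F.bottom j).weight i ≤ k} with hL
  have hn : n ≤ #L + k := le_card_light_add hk
  let e := L.orderEmbOfFin rfl
  -- The chain of inputs along the light variables.
  let A (s : ℕ) : Finset (Fin n) := ({t : Fin #L | t.1 < s} : Finset (Fin #L)).map e.toEmbedding
  have hflip : ∀ p ∈ {p ∈ Ioc k ((n - 1) / 2) | p.Prime}, ∃ j ∈ F.support,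
      ∃ h : (n - 1) / 2 - p < #L, (F.bottom j).Flips (A ((n - 1) / 2 - p)) (e ⟨_, h⟩) := by
    intro p hp
    obtain ⟨hp, hprime⟩ := mem_filter.1 hp
    obtain ⟨hkp, hpn⟩ := mem_Ioc.1 hp
    have h : (n - 1) / 2 - p < #L := by lia
    obtain ⟨j, hj, hfl⟩ := exists_flips_of_prime hk hF hprime hkp
      (A := A ((n - 1) / 2 - p)) (i := e ⟨_, h⟩) (by simp [A])
      (by rw [card_map, Fin.card_filter_val_lt]; lia)
      (mem_filter.1 (L.orderEmbOfFin_mem rfl ⟨_, h⟩)).2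
    exact ⟨j, hj, h, hfl⟩
  refine (card_le_card_of_forall_subsingleton _ hflip ?_).trans (card_support_le hk)
  -- A gate that flips at an earlier step has value one from then on.
  have hmono : ∀ p q j, q ≤ (n - 1) / 2 → p < q →
      (∃ h : (n - 1) / 2 - p < #L, (F.bottom j).Flips (A ((n - 1) / 2 - p)) (e ⟨_, h⟩)) →
      ¬ ∃ h : (n - 1) / 2 - q < #L, (F.bottom j).Flips (A ((n - 1) / 2 - q)) (e ⟨_, h⟩) := by
    rintro p q j hqn hpq ⟨hp, h1, -⟩ ⟨hq, -, h2⟩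
    have hsub : insert (e ⟨_, hq⟩) (A ((n - 1) / 2 - q)) ⊆ A ((n - 1) / 2 - p) := by
      refine insert_subset (mem_map.2 ⟨⟨_, hq⟩, by simp; lia, rfl⟩) (map_subset_map.2 ?_)
      intro t ht
      simp only [mem_filter, mem_univ, true_and] at ht ⊢
      lia
    have := (F.bottom j).value_mono hsub
    lia
  rintro j - p ⟨hp, hpj⟩ q ⟨hq, hqj⟩
  rcases lt_trichotomy p q with h | h | h
  · exact absurd hqj (hmono p q j (mem_Ioc.1 (mem_filter.1 hq).1).2 h hpj)
  · exact h
  · exact absurd hpj (hmono q p j (mem_Ioc.1 (mem_filter.1 hp).1).2 h hqj)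

theorem primeCounting_le_two_mul (hk : F.WeightAtMost k) (hF : F.ComputesMajority) :
    Nat.primeCounting ((n - 1) / 2) ≤ 2 * k := by
  rw [← Nat.primesLE_card_eq_primeCounting]
  have hsub : Nat.primesLE ((n - 1) / 2) ⊆
      Ioc 0 k ∪ {p ∈ Ioc k ((n - 1) / 2) | p.Prime} := by
    intro p hp
    rw [Nat.mem_primesLE] at hp
    have := hp.2.pos
    simp only [mem_union, mem_filter, mem_Ioc, hp.2]
    lia
  refine (card_le_card hsub).trans ((card_union_le _ _).trans ?_)
  have := card_primes_le hk hF
  rw [Nat.card_Ioc]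
  lia

theorem one_le_of_weightAtMost (hn : 2 ≤ n) (hk : F.WeightAtMost k) (hF : F.ComputesMajority) :
    1 ≤ k := by
  obtain ⟨S, -, hS⟩ := exists_subset_card_eq (s := (univ : Finset (Fin n)))
    (n := (n + 1) / 2 - 1) (by rw [card_univ, Fintype.card_fin]; lia)
  obtain ⟨i, -, hi⟩ := exists_mem_notMem_of_card_lt_card (s := S) (t := univ)
    (by rw [card_univ, Fintype.card_fin]; lia)
  obtain ⟨j, hj, -⟩ := exists_flips hF hi (by lia)
  exact (card_pos.2 ⟨j, hj⟩).trans_le (card_support_le hk)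

end DepthTwoCircuit

/-! ### From primes to the bound -/

theorem div_le_mul_log_of_primeCounting_le {n k : ℕ} (hn : 2 ≤ n) (hk : 1 ≤ k)
    (h : Nat.primeCounting ((n - 1) / 2) ≤ 2 * k) : (n : ℝ) / 32 ≤ k * Real.log n := by
  have hk' : (1 : ℝ) ≤ k := by exact_mod_cast hk
  have hn' : (2 : ℝ) ≤ n := by exact_mod_cast hn
  have hlog2 := Real.log_two_gt_d9
  have hlog2' := Real.log_two_lt_d9
  -- The estimate of `π` is too weak for small `n`, where `1 ≤ k` is enough.
  rcases lt_or_ge n 16 with hlt | hge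
  · have hlt' : (n : ℝ) ≤ 16 := by exact_mod_cast hlt.le
    have : Real.log 2 ≤ Real.log n := Real.log_le_log two_pos hn'
    nlinarith
  · set N := (n - 1) / 2 with hN
    have hnN : (n : ℝ) ≤ 2 * N + 2 := by exact_mod_cast (by lia : n ≤ 2 * N + 2)
    have hNn : (N : ℝ) ≤ n := by exact_mod_cast (by lia : N ≤ n)
    have hN7 : (7 : ℝ) ≤ N := by exact_mod_cast (by lia : 7 ≤ N)
    have hpi := Chebyshev.pi_ge N
    have hpos : 0 < Real.log N := Real.log_pos (by linarith)
    rw [div_le_iff₀ hpos] at hpi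
    have h' : (Nat.primeCounting N : ℝ) ≤ 2 * k := by exact_mod_cast h
    -- The tangent of the logarithm at `8`.
    have htan : Real.log (N + 1) ≤ (N + 1) / 8 - 1 + 3 * Real.log 2 := by
      have h8 : Real.log 8 = 3 * Real.log 2 := by
        rw [show (8 : ℝ) = 2 ^ 3 by norm_num, Real.log_pow]; norm_num
      have := Real.log_le_sub_one_of_pos (x := ((N : ℝ) + 1) / 8) (by positivity)
      rw [Real.log_div (by positivity) (by norm_num), h8] at this
      linarith
    have h1 : (N : ℝ) / 4 ≤ N * Real.log 2 - Real.log (N + 1) := by nlinarith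
    have h2 : (Nat.primeCounting N : ℝ) * Real.log N ≤ 2 * k * Real.log n :=
      mul_le_mul h' (Real.log_le_log (by linarith) hNn) hpos.le (by positivity)
    linarith

theorem rpow_mul_log_rpow_mul_log_le {n : ℕ} (hn : 2 ≤ n) :
    (n : ℝ) ^ ((13 : ℝ) / 19) * Real.log n ^ (-(2 : ℝ) / 19) * Real.log n ≤ 3 * n := by
  have hn' : (1 : ℝ) < n := by exact_mod_cast hn
  have hpos : 0 < Real.log n := Real.log_pos hn'
  have hlog : Real.log n ≤ 3 * (n : ℝ) ^ ((6 : ℝ) / 17) := by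
    have h := Real.log_le_rpow_div (x := (n : ℝ)) (by positivity) (by norm_num : (0 : ℝ) < 6 / 17)
    have h0 : (0 : ℝ) ≤ (n : ℝ) ^ ((6 : ℝ) / 17) := by positivity
    rw [le_div_iff₀ (by norm_num)] at h
    linarith
  calc (n : ℝ) ^ ((13 : ℝ) / 19) * Real.log n ^ (-(2 : ℝ) / 19) * Real.log n
      = (n : ℝ) ^ ((13 : ℝ) / 19) * Real.log n ^ ((17 : ℝ) / 19) := by
        rw [mul_assoc, ← Real.rpow_add_one hpos.ne']; norm_num
    _ ≤ (n : ℝ) ^ ((13 : ℝ) / 19) * (3 * (n : ℝ) ^ ((6 : ℝ) / 17)) ^ ((17 : ℝ) / 19) := by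
        gcongr
    _ = (n : ℝ) ^ ((13 : ℝ) / 19) * (3 ^ ((17 : ℝ) / 19) * (n : ℝ) ^ ((6 : ℝ) / 19)) := by
        rw [Real.mul_rpow (by norm_num) (by positivity), ← Real.rpow_mul (by positivity)]
        norm_num
    _ = 3 ^ ((17 : ℝ) / 19) * n := by
        rw [mul_left_comm, ← Real.rpow_add (by linarith)]; norm_num
    _ ≤ 3 * n := by
        gcongr
        exact (Real.rpow_le_rpow_of_exponent_le (by norm_num) (by norm_num)).trans_eq
          (Real.rpow_one 3)

theorem mainTheorem1 :
    ∃ c : ℝ, 0 < c ∧ ∀ n : ℕ, 2 ≤ n → ∀ (k : ℕ) (F : DepthTwoCircuit n),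
      F.WeightAtMost k → F.ComputesMajority →
        c * ((n : ℝ) ^ ((13 : ℝ) / 19) * Real.log (n : ℝ) ^ (-(2 : ℝ) / 19)) ≤ (k : ℝ) := by
  refine ⟨1 / 96, by norm_num, fun n hn k F hk hF => ?_⟩
  have hpos : 0 < Real.log n := Real.log_pos (by exact_mod_cast hn)
  have h1 := div_le_mul_log_of_primeCounting_le hn (DepthTwoCircuit.one_le_of_weightAtMost hn hk hF)
    (DepthTwoCircuit.primeCounting_le_two_mul hk hF)
  have h2 := rpow_mul_log_rpow_mul_log_le hn
  refine le_of_mul_le_mul_right ?_ hpos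
  linarith
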